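/- Let $\mathbf{k}$ be a field of characteristic $0$, let $n \ge 0$ and $k \ge 2$ be integers, and let $I_{n,k} = (x_1^2,\dots,x_n^2,(x_1+\cdots+x_n)^k) \subseteq \mathbf{k}[x_1,\dots,x_n]$. Let $\mathcal{A}$ be the family of those subsets that are minimal with respect to inclusion among the nonempty subsets $A \subseteq \{1,\dots,n\}$ satisfying $\max(A) = 2|A|-k$. For $A \in \mathcal{A}$ with $|A| = d$, let $$g_{A,n,k} = e_d\big(x_i : i \in A \cup \{2d-k+1,\dots,n\}\big)$$ be the elementary symmetric polynomial of degree $d$ in the variables indexed by $A \cup \{2d-k+1,\dots,n\}$. Let $\prec$ be any term order on $\mathbf{k}[x_1,\dots,x_n]$ that induces the block variable ranking $\{x_1,\dots,x_k\} \succ \{x_{k+1},x_{k+2}\} \succ \{x_{k+3},x_{k+4}\} \succ \cdots$ (the last block is a single variable if $n-k$ is odd and positive, and there is only the block $\{x_1,\dots,x_n\}$ if $n \le k$), that is, every variable of an earlier block is larger than every variable of a later block, with no condition inside a block. Then the reduced Gröbner basis of $I_{n,k}$ with respect to $\prec$ is $$G_{n,k} = \{x_1^2,\dots,x_n^2\}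 \cup \bigcup_{d=k}^{k+\lfloor (n-k)/2\rfloor} \{ g_{A,n,k} : A \in \mathcal{A},\ |A| = d\},$$ and the leading term of $g_{A,n,k}$ is $x_A = \prod_{a\in A} x_a$ for every $A \in \mathcal{A}$. Moreover, every $A \in \mathcal{A}$ satisfies $k \le |A| \le k + \lfloor (n-k)/2\rfloor$; for $|A| = d$ the set $A \cup \{2d-k+1,\dots,n\}$ has $n-d+k$ elements and $g_{A,n,k}$ is supported on $\binom{n-d+k}{d}$ terms. Finally, for every $r \ge 0$ the number of $A \in \mathcal{A}$ with $|A| = k+r$ is $0$ if $n < 2r+k$, and otherwise it is $C_r^{k-1}$, the $r$-th term of the $(k-1)$-fold self-convolution of the Catalan numbers $C_i$, i.e. the coefficient of $t^r$ in $\big(\sum_{i\ge 0} C_i t^i\big)^k$. -/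

import Mathlib

/-! The variable `x_i` (`1 ≤ i ≤ n`) is `MvPolynomial.X` of the element of `Fin n` with value `i - 1`;
`varIndex` recovers `i`. -/

noncomputable section

namespace SquareGroebner

open MvPolynomial

/-! ### Gröbner bases -/

section General

variable {σ : Type*} {K : Type*} [Field K]

/-- The initial ideal `in(I)` with respect to a term order. -/
def initialIdeal (m : MonomialOrder σ) (I : Ideal (MvPolynomial σ K)) :
    Ideal (MvPolynomial σ K) :=
  Ideal.span (m.leadingTerm '' (I : Set (MvPolynomial σ K)))

/-- A Gröbner basis of `I`: a finite set of elements of `I` whose leading terms generate `in(I)`. -/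
structure IsGroebnerBasis (m : MonomialOrder σ) (I : Ideal (MvPolynomial σ K))
    (G : Set (MvPolynomial σ K)) : Prop where
  finite : G.Finite
  subset : G ⊆ (I : Set (MvPolynomial σ K))
  span_eq : Ideal.span (m.leadingTerm '' G) = initialIdeal m I

/-- Exponents of the minimal monomial generators of a monomial ideal `J`: the monomials of `J`
that are minimal with respect to divisibility. -/
def minimalMonomials (J : Ideal (MvPolynomial σ K)) : Set (σ →₀ ℕ) :=
  {s | Minimal (fun t : σ →₀ ℕ => (monomial t (1 : K)) ∈ J) s}

/-- A reduced Gröbner basis of `I`: a Gröbner basis that is in bijection, by taking leading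
monomials, with the minimal generating set of `in(I)`, whose elements have leading coefficient `1`
and tails consisting of monomials outside `in(I)`. -/
structure IsReducedGroebnerBasis (m : MonomialOrder σ) (I : Ideal (MvPolynomial σ K))
    (G : Set (MvPolynomial σ K)) : Prop extends IsGroebnerBasis m I G where
  bijOn : Set.BijOn (fun g : MvPolynomial σ K => m.degree g) G
    (minimalMonomials (initialIdeal m I))
  monic : ∀ g ∈ G, m.leadingCoeff g = 1
  tail : ∀ g ∈ G, ∀ s ∈ g.support, s ≠ m.degree g → monomial s (1 : K) ∉ initialIdeal m I

end General

/-! ### The ideal, the family of index sets and the polynomials -/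

/-- The index in `{1, …, n}` of a variable. -/
def varIndex {n : ℕ} (i : Fin n) : ℕ := (i : ℕ) + 1

/-- The ideal `(x_1^2, …, x_n^2, (x_1 + ⋯ + x_n)^k)`. -/
def squareIdeal (K : Type*) [Field K] (n k : ℕ) : Ideal (MvPolynomial (Fin n) K) :=
  Ideal.span (Set.range (fun i : Fin n => (X i : MvPolynomial (Fin n) K) ^ 2) ∪
    {(∑ i : Fin n, (X i : MvPolynomial (Fin n) K)) ^ k})

/-- The condition `max(A) = 2|A| - k` (an equation of integers) on a nonempty `A ⊆ {1, …, n}`. -/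
def MaxCondition {n : ℕ} (k : ℕ) (A : Finset (Fin n)) : Prop :=
  A.Nonempty ∧ ((A.sup varIndex : ℕ) : ℤ) = 2 * (A.card : ℤ) - (k : ℤ)

/-- The family `𝒜` of the inclusion-minimal sets among those with `max(A) = 2|A| - k`. -/
def minimalFamily (n k : ℕ) : Set (Finset (Fin n)) :=
  {A | Minimal (fun B : Finset (Fin n) => MaxCondition k B) A}

/-- The index set `A ∪ {2|A| - k + 1, …, n}`. -/
def indexSet {n : ℕ} (k : ℕ) (A : Finset (Fin n)) : Finset (Fin n) :=
  A ∪ Finset.univ.filter (fun i : Fin n => 2 * (A.card : ℤ) - (k : ℤ) + 1 ≤ (varIndex i : ℤ))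

/-- `g_{A,n,k}`: the elementary symmetric polynomial of degree `|A|` in the variables indexed by
`A ∪ {2|A| - k + 1, …, n}`. -/
def gPoly (K : Type*) [Field K] {n : ℕ} (k : ℕ) (A : Finset (Fin n)) : MvPolynomial (Fin n) K :=
  ((indexSet k A).val.map (fun i : Fin n => (X i : MvPolynomial (Fin n) K))).esymm A.card

/-- The set `G_{n,k}`. Note that `(n + k) / 2 = k + ⌊(n - k) / 2⌋`. -/
def basisSet (K : Type*) [Field K] (n k : ℕ) : Set (MvPolynomial (Fin n) K) :=
  Set.range (fun i : Fin n => (X i : MvPolynomial (Fin n) K) ^ 2) ∪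
    ⋃ d ∈ Finset.Icc k ((n + k) / 2), {g | ∃ A ∈ minimalFamily n k, A.card = d ∧ g = gPoly K k A}

/-! ### Term orders -/

/-- The position of `x_i` in the ordered partition
`{x_1, …, x_k}, {x_{k+1}, x_{k+2}}, {x_{k+3}, x_{k+4}}, …` (the last block may be a singleton). -/
def blockIndex {n : ℕ} (k : ℕ) (i : Fin n) : ℕ :=
  if varIndex i ≤ k then 0 else (varIndex i - k + 1) / 2

/-- The term order induces the block variable ranking
`{x_1, …, x_k} ≻ {x_{k+1}, x_{k+2}} ≻ {x_{k+3}, x_{k+4}} ≻ ⋯`; inside a block, the variables may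
be ranked in any way. -/
def InducesBlockRanking {n : ℕ} (k : ℕ) (m : MonomialOrder (Fin n)) : Prop :=
  ∀ i j : Fin n, blockIndex k i < blockIndex k j →
    m.toSyn (Finsupp.single j 1) < m.toSyn (Finsupp.single i 1)

/-! ### Convolutions -/

/-- The `r`-th term of the `j`-fold self-convolution of `a`: the coefficient of `t^r` in
`(∑ a_i t^i)^(j+1)`. -/
def selfConvolution (a : ℕ → ℕ) (j r : ℕ) : ℕ :=
  PowerSeries.coeff r ((PowerSeries.mk a) ^ (j + 1))

end SquareGroebner

end

open SquareGroebner

noncomputable section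

namespace SquareGroebner

/-! ### Lattice walks -/

open Finset

/-! Read a subset of {1, …, n} as a walk with an up step at each element and a down step elsewhere.
The condition max(A) = 2|A| - k says that the walk of A stands at height k right after its last up
step, so a square-free monomial is divisible by some x_A with A in 𝒜 exactly when its walk reaches
height k (`finReaches_iff`).

Modulo the squares, the d-th power of a sum of variables is d! times their e_d. The sum over the
index set of A is x_1 + ⋯ + x_n, nilpotent of order k, minus a sum of |A| - k variables, nilpotent
of order |A| - k + 1; hence its |A|-th power vanishes, and in characteristic 0 the polynomial g_A
lies in the ideal. The variables of g_A outside A all lie in later blocks than those of A, so its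
leading monomial is x_A.

That nothing else is needed is a dimension count. The square-free parts of elements of the ideal lie
in the span of the square-free parts of x_S (x_1 + ⋯ + x_n)^k with 2|S| + k ≤ n and of all x_S with
2|S| > n + k. By the reflection principle there are as many of these vectors as walks reaching
height k (`card_small_add_card_large`). The multiples of the g_A already realise that many leading
monomials, so one more would exceed the dimension (`exists_two_le_or_finReaches_degree`).

The sets in 𝒜 are first-passage walks; reflection counts them by a difference of binomials, which is
a coefficient of a power of the Catalan series. -/

/-- The walk of `S`, which at time `i` goes up if `i ∈ S` and down otherwise, reaches height `k`. -/
def Reaches (k : ℕ) (S : Finset ℕ) : Prop :=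
  ∃ j, j + k ≤ 2 * (S.filter (· < j)).card

theorem card_filter_lt_le (S : Finset ℕ) (j : ℕ) : (S.filter (· < j)).card ≤ j := by
  calc (S.filter (· < j)).card ≤ (range j).card :=
        card_le_card fun x hx => by simpa using (mem_filter.1 hx).2
    _ = j := card_range j

theorem Reaches.le_card {k : ℕ} {S : Finset ℕ} (h : Reaches k S) : k ≤ S.card := by
  obtain ⟨j, hj⟩ := h
  have h1 := card_filter_lt_le S j
  have h2 : (S.filter (· < j)).card ≤ S.card := card_filter_le _ _
  omega

theorem reaches_of_le {k n : ℕ} {S : Finset ℕ} (hS : S ⊆ range n) (h : n + k ≤ 2 * S.card) :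
    Reaches k S := by
  refine ⟨n, ?_⟩
  rwa [filter_true_of_mem fun x hx => mem_range.1 (hS hx)]

/-- The bound says that the walk ends below height k even after the added up step, so only times up
to n can witness the passage. -/
theorem reaches_insert_iff {k n : ℕ} {S : Finset ℕ} (hS : S ⊆ range n)
    (h : 2 * (S.card + 1) < n + 1 + k) : Reaches k (insert n S) ↔ Reaches k S := by
  have hn : n ∉ S := fun hn => by simpa using hS hn
  constructor
  · rintro ⟨j, hj⟩
    by_cases hnj : n < j
    · have : ((insert n S).filter (· < j)).card ≤ S.card + 1 :=
        (card_filter_le _ _).trans (card_insert_le _ _)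
      omega
    · refine ⟨j, ?_⟩
      rwa [filter_insert, if_neg hnj] at hj
  · rintro ⟨j, hj⟩
    exact ⟨j, hj.trans (Nat.mul_le_mul_left _ (card_le_card
      (filter_subset_filter _ (subset_insert _ _))))⟩

open Classical in
/-- The reflection principle: the walks of length `n` with `s + k` steps up that reach height `k`
are as many as the walks with `s` steps up. -/
theorem card_reaches {k : ℕ} (hk : 1 ≤ k) (n s : ℕ) (h : 2 * s + k ≤ n) :
    (((range n).powersetCard (s + k)).filter (Reaches k)).card = n.choose s := by
  induction n generalizing s with
  | zero => omega
  | succ n ih =>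
    -- In the equality case every walk ends at height k, hence reaches it. Otherwise the endpoint is
    -- lower, the last step can be dropped, and the count obeys Pascal's rule.
    by_cases heq : 2 * s + k = n + 1
    · rw [filter_true_of_mem, card_powersetCard, card_range]
      · rw [Nat.choose_symm_of_eq_add]; omega
      · intro S hS
        rw [mem_powersetCard] at hS
        exact reaches_of_le hS.1 (by omega)
    · obtain ⟨l, hl⟩ : ∃ l, s + k = l + 1 := ⟨s + k - 1, by omega⟩
      have hstep : (((range (n + 1)).powersetCard (s + k)).filter (Reaches k)).card =
          (((range n).powersetCard (l + 1)).filter (Reaches k)).card +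
          (((range n).powersetCard l).filter (Reaches k)).card := by
        rw [hl, range_add_one, powersetCard_succ_insert (by simp), filter_union,
          card_union_of_disjoint, filter_image]
        · congr 1
          rw [card_image_of_injOn]
          · congr 1
            refine filter_congr fun S hS => ?_
            rw [mem_powersetCard] at hS
            exact reaches_insert_iff hS.1 (by omega)
          · intro S hS T hT hST
            simp only [coe_filter, mem_powersetCard, Set.mem_ofPred_eq] at hS hT
            have hS' : n ∉ S := fun hn => by simpa using hS.1.1 hn
            have hT' : n ∉ T := fun hn => by simpa using hT.1.1 hn
            rw [← erase_insert hS', ← erase_insert hT']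
            exact congrArg (fun U => U.erase n) hST
        · rw [disjoint_left]
          intro S hS hS'
          simp only [mem_filter, mem_powersetCard, mem_image] at hS hS'
          obtain ⟨⟨T, -, rfl⟩, -⟩ := hS'
          simpa using hS.1.1 (mem_insert_self n T)
      rw [hstep, ← hl, ih s (by omega)]
      -- For s = 0 the walks ending in an up step have only k - 1 earlier up steps, too few to reach
      -- k.
      cases s with
      | zero =>
        rw [filter_false_of_mem]
        · simp
        · intro S hS hr
          have := hr.le_card
          rw [mem_powersetCard] at hS
          omega
      | succ s =>
        have : l = s + k := by omega
        rw [this, ih s (by omega), Nat.choose_succ_succ, add_comm]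

/-! ### The minimal family -/

section Family

variable {n k : ℕ}

/-- The walk of a subset of `Fin n` reaches height `k`. -/
def FinReaches (k : ℕ) (S : Finset (Fin n)) : Prop := Reaches k (S.map Fin.valEmbedding)

theorem card_filter_map_val (S : Finset (Fin n)) (j : ℕ) :
    ((S.map Fin.valEmbedding).filter (· < j)).card = (S.filter (fun i : Fin n => (i : ℕ) < j)).card := by
  rw [filter_map, card_map]; rfl

theorem map_val_subset (S : Finset (Fin n)) : S.map Fin.valEmbedding ⊆ range n := by
  intro x; simp only [mem_map, mem_range]; rintro ⟨i, -, rfl⟩; exact i.2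

theorem maxCondition_iff {A : Finset (Fin n)} :
    MaxCondition k A ↔ ∃ i ∈ A, (∀ x ∈ A, x ≤ i) ∧ (i : ℕ) + 1 + k = 2 * A.card := by
  unfold MaxCondition
  constructor
  · rintro ⟨hA, h⟩
    obtain ⟨i, hi, hs⟩ := exists_mem_eq_sup A hA varIndex
    refine ⟨i, hi, fun x hx => ?_, ?_⟩
    · have := le_sup (f := varIndex) hx
      rw [hs] at this
      simp only [varIndex] at this
      exact Fin.le_def.2 (by omega)
    · rw [hs] at h
      simp only [varIndex] at h
      omega
  · rintro ⟨i, hi, hmax, h⟩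
    refine ⟨⟨i, hi⟩, ?_⟩
    have : A.sup varIndex = (i : ℕ) + 1 := by
      apply le_antisymm
      · refine Finset.sup_le fun x hx => ?_
        have := Fin.le_def.1 (hmax x hx)
        simp only [varIndex]; omega
      · exact le_sup (f := varIndex) hi
    rw [this]; push_cast; omega

theorem MaxCondition.finReaches {A S : Finset (Fin n)} (h : MaxCondition k A) (hAS : A ⊆ S) :
    FinReaches k S := by
  obtain ⟨i, hi, hmax, hc⟩ := maxCondition_iff.1 h
  refine ⟨i + 1, ?_⟩
  rw [card_filter_map_val, hc]
  refine Nat.mul_le_mul_left _ (card_le_card fun x hx => mem_filter.2 ⟨hAS hx, ?_⟩)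
  have := Fin.le_def.1 (hmax x hx)
  omega

/-- Cut the walk at the first time it reaches k. The step leading there is up and the height is then
exactly k, so the up steps so far satisfy the condition. Positivity of k excludes time 0. -/
theorem FinReaches.exists_maxCondition (hk : 1 ≤ k) {S : Finset (Fin n)} (h : FinReaches k S) :
    ∃ A ⊆ S, MaxCondition k A := by
  classical
  have h' : ∃ j, j + k ≤ 2 * (S.filter (fun i : Fin n => (i : ℕ) < j)).card := by
    obtain ⟨j, hj⟩ := h
    exact ⟨j, by rwa [card_filter_map_val] at hj⟩
  obtain ⟨j, hj⟩ : ∃ j, j = Nat.find h' := ⟨_, rfl⟩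
  have hspec := Nat.find_spec h'
  rw [← hj] at hspec
  cases j with
  | zero => simp at hspec; omega
  | succ j =>
    have hmin := Nat.find_min h' (m := j) (by omega)
    have hsub : S.filter (fun i : Fin n => (i : ℕ) < j) ⊆ S.filter (fun i : Fin n => (i : ℕ) < j + 1) :=
      fun x hx => by
        rw [mem_filter] at hx ⊢
        exact ⟨hx.1, by omega⟩
    have hex : ∃ i ∈ S, (i : ℕ) = j := by
      by_contra! hne
      have : S.filter (fun i : Fin n => (i : ℕ) < j) = S.filter (fun i : Fin n => (i : ℕ) < j + 1) :=
        filter_congr fun x hx => by have := hne x hx; omega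
      rw [this] at hmin
      omega
    obtain ⟨i, hiS, rfl⟩ := hex
    have hins : S.filter (fun x : Fin n => (x : ℕ) < i + 1) =
        insert i (S.filter (fun x : Fin n => (x : ℕ) < i)) := by
      ext x
      simp only [mem_filter, mem_insert, Fin.ext_iff]
      constructor
      · rintro ⟨h1, h2⟩
        by_cases hx : (x : ℕ) = i
        · exact Or.inl hx
        · exact Or.inr ⟨h1, by omega⟩
      · rintro (hx | ⟨h1, h2⟩)
        · rw [← Fin.ext_iff] at hx; subst hx; exact ⟨hiS, by omega⟩
        · exact ⟨h1, by omega⟩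
    have hcard : (S.filter (fun x : Fin n => (x : ℕ) < i + 1)).card =
        (S.filter (fun x : Fin n => (x : ℕ) < i)).card + 1 := by
      rw [hins, card_insert_of_notMem (by simp)]
    refine ⟨S.filter (fun x : Fin n => (x : ℕ) < i + 1), filter_subset _ _, maxCondition_iff.2
      ⟨i, by simp [hiS], fun x hx => ?_, by omega⟩⟩
    rw [mem_filter] at hx
    exact Fin.le_def.2 (by omega)

theorem finReaches_iff (hk : 1 ≤ k) {S : Finset (Fin n)} :
    FinReaches k S ↔ ∃ A ∈ minimalFamily n k, A ⊆ S := by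
  constructor
  · intro h
    obtain ⟨B, hBS, hB⟩ := h.exists_maxCondition hk
    obtain ⟨A, hAB, hA⟩ := (Set.toFinite {B : Finset (Fin n) | MaxCondition k B}).exists_le_minimal
      (show B ∈ _ from hB)
    exact ⟨A, hA, hAB.trans hBS⟩
  · rintro ⟨A, hA, hAS⟩
    exact hA.prop.finReaches hAS

theorem MaxCondition.le_card {A : Finset (Fin n)} (h : MaxCondition k A) : k ≤ A.card := by
  have := (h.finReaches subset_rfl).le_card
  rwa [card_map] at this

theorem MaxCondition.two_mul_card_le {A : Finset (Fin n)} (h : MaxCondition k A) :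
    2 * A.card ≤ n + k := by
  obtain ⟨i, -, -, hc⟩ := maxCondition_iff.1 h
  have := i.2
  omega

/-- A set with `max(B) = 2|B| - k` inside `A` and later positions, and of size at most `|A|`, is
the minimal set `A` itself. -/
theorem eq_of_maxCondition_of_subset {A B : Finset (Fin n)} (hA : A ∈ minimalFamily n k)
    (hB : MaxCondition k B) (hcard : B.card ≤ A.card)
    (hsub : ∀ i ∈ B, (i : ℕ) + k < 2 * A.card → i ∈ A) : B = A := by
  obtain ⟨i, hi, hmax, hc⟩ := maxCondition_iff.1 hB
  have hBA : B ⊆ A := fun x hx => hsub x hx (by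
    have := Fin.le_def.1 (hmax x hx)
    omega)
  exact hBA.antisymm (hA.le_of_le hB hBA)

/-! ### Sets that reach height k, counted by size -/

open Classical in
theorem card_filter_card_eq (P : Finset ℕ → Prop) (s : ℕ) :
    (univ.filter (fun S : Finset (Fin n) => S.card = s ∧ P (S.map Fin.valEmbedding))).card =
      (((range n).powersetCard s).filter P).card := by
  have hr : range n = (univ : Finset (Fin n)).map Fin.valEmbedding := by
    ext x
    simp only [mem_range, mem_map, mem_univ, true_and]
    exact ⟨fun h => ⟨⟨x, h⟩, rfl⟩, by rintro ⟨i, rfl⟩; exact i.2⟩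
  rw [hr, powersetCard_map, filter_map, card_map]
  congr 1
  ext S
  simp [mem_powersetCard]

-- Reflection matches the sets of size s, 2s + k ≤ n, with the reaching sets of size s + k. Sets
-- with more than (n + k)/2 elements end above height k and all reach it.
open Classical in
theorem card_small_add_card_large (hk : 1 ≤ k) :
    (univ.filter (fun S : Finset (Fin n) => 2 * S.card + k ≤ n)).card +
      (univ.filter (fun S : Finset (Fin n) => n + k < 2 * S.card)).card =
      (univ.filter (fun S : Finset (Fin n) => FinReaches k S)).card := by
  have hsplit := card_filter_add_card_filter_not
    (s := univ.filter (fun S : Finset (Fin n) => FinReaches k S)) (fun S => 2 * S.card ≤ n + k)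
  rw [← hsplit]
  congr 1
  · rw [card_eq_sum_card_fiberwise (f := fun S => S.card)
      (t := (range (n + 1)).filter (fun s => 2 * s + k ≤ n)),
      -- The truncated subtraction is harmless: a reaching set has at least k elements.
      card_eq_sum_card_fiberwise (f := fun S => S.card - k)
      (t := (range (n + 1)).filter (fun s => 2 * s + k ≤ n))]
    · refine sum_congr rfl fun s hs => ?_
      rw [mem_filter] at hs
      trans n.choose s
      · have := card_filter_card_eq (n := n) (fun _ => True) s
        simp only [and_true, filter_true, card_powersetCard, card_range] at this
        rw [← this, filter_filter]
        congr 1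
        refine filter_congr fun S _ => ⟨fun h => h.2, fun h => ⟨by omega, h⟩⟩
      · rw [← card_reaches hk n s hs.2, ← card_filter_card_eq, filter_filter, filter_filter]
        congr 1
        refine filter_congr fun S _ => ?_
        constructor
        · rintro ⟨h2, h1⟩
          exact ⟨h1, by omega, by omega⟩
        · rintro ⟨h1, h2, h3⟩
          have := h1.le_card
          rw [card_map] at this
          exact ⟨by omega, h1⟩
    · intro S hS
      simp only [coe_filter, mem_filter, mem_univ, true_and, Set.mem_ofPred_eq, mem_range] at hS ⊢
      have := hS.1.le_card
      rw [card_map] at this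
      omega
    · intro S hS
      simp only [coe_filter, mem_univ, true_and, Set.mem_ofPred_eq, mem_range] at hS ⊢
      omega
  · congr 1
    ext S
    simp only [mem_filter, mem_univ, true_and, not_le]
    refine ⟨fun h => ⟨reaches_of_le (map_val_subset S) ?_, h⟩, fun h => h.2⟩
    rw [card_map]
    omega

/-! ### Counting the minimal family -/

/-- The functional equation C = 1 + t C², multiplied by C^k. -/
theorem coeff_catalanSeries_pow_succ (k r : ℕ) :
    PowerSeries.coeff (r + 1) (PowerSeries.catalanSeries ^ (k + 1)) =
      PowerSeries.coeff (r + 1) (PowerSeries.catalanSeries ^ k) +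
      PowerSeries.coeff r (PowerSeries.catalanSeries ^ (k + 2)) := by
  have h : PowerSeries.catalanSeries ^ (k + 1) = PowerSeries.catalanSeries ^ k +
      PowerSeries.catalanSeries ^ (k + 2) * PowerSeries.X := by
    have h' : PowerSeries.catalanSeries ^ (k + 1) = PowerSeries.catalanSeries ^ k *
        (PowerSeries.catalanSeries ^ 2 * PowerSeries.X + 1) := by
      rw [PowerSeries.catalanSeries_sq_mul_X_add_one, pow_succ]
    rw [h']
    ring
  rw [h, map_add, PowerSeries.coeff_succ_mul_X]

theorem coeff_zero_catalanSeries_pow (k : ℕ) :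
    PowerSeries.coeff 0 (PowerSeries.catalanSeries ^ k) = 1 := by
  simp

/-- The ballot formula, with the subtracted binomial moved to the left to stay in ℕ. Both sides obey
the same recurrence, by the functional equation and Pascal's rule; the induction is on r, then on k.
-/
theorem coeff_catalanSeries_pow (k r : ℕ) :
    PowerSeries.coeff (r + 1) (PowerSeries.catalanSeries ^ (k + 1)) + (k + 2 * r + 2).choose r =
      (k + 2 * r + 2).choose (r + 1) := by
  induction r generalizing k with
  | zero =>
    induction k with
    | zero => rw [coeff_catalanSeries_pow_succ]; simp [PowerSeries.coeff_one]
    | succ k ih =>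
      rw [coeff_catalanSeries_pow_succ, coeff_zero_catalanSeries_pow]
      simp at ih ⊢
      omega
  | succ r ihr =>
    induction k with
    | zero =>
      have h := ihr 1
      rw [coeff_catalanSeries_pow_succ, pow_zero, PowerSeries.coeff_one, if_neg (by omega)]
      have e : 0 + 2 * (r + 1) + 2 = (1 + 2 * r + 2) + 1 := by ring
      have hs : (1 + 2 * r + 2).choose (r + 1 + 1) = (1 + 2 * r + 2).choose (r + 1) :=
        Nat.choose_symm_of_eq_add (by ring)
      rw [e, Nat.choose_succ_succ _ r, Nat.choose_succ_succ _ (r + 1), Nat.succ_eq_add_one,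
        Nat.succ_eq_add_one, hs, ← h]
      ring
    | succ k ih =>
      have h := ihr (k + 2)
      rw [coeff_catalanSeries_pow_succ]
      have e : k + 1 + 2 * (r + 1) + 2 = (k + 2 + 2 * r + 2) + 1 := by ring
      have e' : k + 2 * (r + 1) + 2 = k + 2 + 2 * r + 2 := by ring
      rw [e'] at ih
      rw [e, Nat.choose_succ_succ _ r, Nat.choose_succ_succ _ (r + 1), Nat.succ_eq_add_one,
        Nat.succ_eq_add_one, ← ih, ← h]
      ring

-- These walks end at height k - 1. For positive r, discarding the reaching ones by reflection
-- leaves the difference of binomials in `coeff_catalanSeries_pow`.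
open Classical in
theorem card_not_reaches (r : ℕ) (hk : 1 ≤ k) :
    (((range (k + 2 * r - 1)).powersetCard (k + r - 1)).filter (fun S => ¬ Reaches k S)).card =
      PowerSeries.coeff r (PowerSeries.catalanSeries ^ k) := by
  obtain ⟨k, rfl⟩ : ∃ l, k = l + 1 := ⟨k - 1, by omega⟩
  cases r with
  | zero =>
    rw [coeff_zero_catalanSeries_pow, filter_true_of_mem]
    · simp
    · intro S hS hr
      have := hr.le_card
      rw [mem_powersetCard] at hS
      omega
  | succ r =>
    have h1 := card_filter_add_card_filter_not
      (s := (range (k + 2 * r + 2)).powersetCard (r + (k + 1))) (Reaches (k + 1))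
    rw [card_reaches (by omega) _ _ (by omega), card_powersetCard, card_range] at h1
    have h2 := coeff_catalanSeries_pow k r
    have h3 : (k + 2 * r + 2).choose (r + (k + 1)) = (k + 2 * r + 2).choose (r + 1) :=
      Nat.choose_symm_of_eq_add (by ring)
    have e1 : k + 1 + 2 * (r + 1) - 1 = k + 2 * r + 2 := by omega
    have e2 : k + 1 + (r + 1) - 1 = r + (k + 1) := by omega
    rw [e1, e2]
    omega

/-- First-passage decomposition: the maximum is forced to be 2(k + r) - k, that is k + 2r - 1
counted from 0, and minimality means that the walk without this last up step never reaches k. -/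
theorem mem_minimalFamily_iff {A : Finset (Fin n)} {r : ℕ} (hk : 1 ≤ k) :
    A ∈ minimalFamily n k ∧ A.card = k + r ↔
      ∃ S ∈ (range (k + 2 * r - 1)).powersetCard (k + r - 1), ¬ Reaches k S ∧
        A.map Fin.valEmbedding = insert (k + 2 * r - 1) S := by
  constructor
  · rintro ⟨hA, hc⟩
    obtain ⟨i, hi, hmax, h⟩ := maxCondition_iff.1 hA.prop
    have hi' : (i : ℕ) = k + 2 * r - 1 := by omega
    refine ⟨(A.erase i).map Fin.valEmbedding, ?_, fun hr => ?_, ?_⟩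
    · rw [mem_powersetCard, card_map, card_erase_of_mem hi]
      refine ⟨fun x hx => ?_, by omega⟩
      obtain ⟨y, hy, rfl⟩ := mem_map.1 hx
      rw [mem_erase] at hy
      have := Fin.lt_def.1 (lt_of_le_of_ne (hmax y hy.2) hy.1)
      rw [mem_range]
      simpa [← hi'] using this
    · obtain ⟨B, hB, hBA⟩ := FinReaches.exists_maxCondition hk (S := A.erase i) hr
      have := hA.le_of_le hBA (hB.trans (erase_subset _ _))
      exact notMem_erase i A (hB (this hi))
    · have : (k + 2 * r - 1 : ℕ) = Fin.valEmbedding i := hi'.symm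
      rw [this, ← map_insert, insert_erase hi]
  · rintro ⟨S, hS, hr, hAS⟩
    rw [mem_powersetCard] at hS
    have hc : A.card = k + r := by
      rw [← card_map Fin.valEmbedding, hAS, card_insert_of_notMem, hS.2]
      · omega
      · intro h; simpa using hS.1 h
    obtain ⟨i, hi, hi'⟩ : ∃ i ∈ A, Fin.valEmbedding i = k + 2 * r - 1 := by
      rw [← mem_map, hAS]; exact mem_insert_self _ _
    have hi'' : (i : ℕ) = k + 2 * r - 1 := hi'
    refine ⟨?_, hc⟩
    have hmc : MaxCondition k A := by
      refine maxCondition_iff.2 ⟨i, hi, fun x hx => ?_, by omega⟩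
      have : Fin.valEmbedding x ∈ A.map Fin.valEmbedding := mem_map_of_mem _ hx
      rw [hAS, mem_insert] at this
      rw [Fin.le_def]
      rcases this with h | h
      · have : (x : ℕ) = k + 2 * r - 1 := h
        omega
      · have : (x : ℕ) < k + 2 * r - 1 := by simpa using hS.1 h
        omega
    refine ⟨hmc, fun B hB hBA => ?_⟩
    by_contra hAB
    -- A smaller B has a smaller maximum 2|B| - k, so it misses the last element of A and lies in S,
    -- forcing S to reach k.
    have hlt : B.card < A.card := card_lt_card ⟨hBA, hAB⟩
    obtain ⟨i', -, hmax', hc'⟩ := maxCondition_iff.1 hB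
    obtain ⟨j, hj⟩ := hB.finReaches (subset_refl B)
    refine hr ⟨j, hj.trans (Nat.mul_le_mul_left _ (card_le_card (filter_subset_filter _ ?_)))⟩
    intro x hx
    obtain ⟨y, hy, rfl⟩ := mem_map.1 hx
    have : Fin.valEmbedding y ∈ A.map Fin.valEmbedding := mem_map_of_mem _ (hBA hy)
    rw [hAS, mem_insert] at this
    refine this.resolve_left fun h => ?_
    have h : (y : ℕ) = k + 2 * r - 1 := h
    have := Fin.le_def.1 (hmax' y hy)
    omega

theorem ncard_minimalFamily (hk : 1 ≤ k) (r : ℕ) :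
    {A : Finset (Fin n) | A ∈ minimalFamily n k ∧ A.card = k + r}.ncard =
      if n < 2 * r + k then 0 else selfConvolution catalan (k - 1) r := by
  classical
  split_ifs with h
  · rw [Set.ncard_eq_zero]
    ext A
    simp only [Set.mem_ofPred_eq, Set.mem_empty_iff_false, iff_false, not_and]
    intro hA hc
    have := hA.prop.two_mul_card_le
    omega
  · have hconv : selfConvolution catalan (k - 1) r =
        PowerSeries.coeff r (PowerSeries.catalanSeries ^ k) := by
      rw [selfConvolution, Nat.sub_add_cancel hk]; rfl
    rw [hconv, ← card_not_reaches r hk, ← card_image_of_injOn (f := insert (k + 2 * r - 1)),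
      ← Set.ncard_coe_finset,
      ← Set.ncard_image_of_injective _ (Finset.map_injective Fin.valEmbedding)]
    · congr 1
      ext T
      simp only [Set.mem_image, Set.mem_ofPred_eq, mem_minimalFamily_iff hk, coe_image, mem_coe, mem_filter]
      constructor
      · rintro ⟨A, ⟨S, hS, hr, hA⟩, rfl⟩
        exact ⟨S, ⟨hS, hr⟩, hA.symm⟩
      · rintro ⟨S, ⟨hS, hr⟩, rfl⟩
        have hsub : ∀ x ∈ insert (k + 2 * r - 1) S, x < n := by
          intro x hx
          rw [mem_insert] at hx
          rcases hx with rfl | hx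
          · omega
          · have := (mem_powersetCard.1 hS).1 hx
            rw [mem_range] at this
            omega
        have : ((insert (k + 2 * r - 1) S).attachFin hsub).map Fin.valEmbedding =
            insert (k + 2 * r - 1) S := by
          ext x
          simp only [mem_map, mem_attachFin, Fin.valEmbedding_apply]
          exact ⟨by rintro ⟨a, ha, rfl⟩; exact ha, fun hx => ⟨⟨x, hsub x hx⟩, hx, rfl⟩⟩
        exact ⟨_, ⟨S, hS, hr, this⟩, this⟩
    · intro S hS T hT hST
      simp only [coe_filter, mem_powersetCard, Set.mem_ofPred_eq] at hS hT
      have hS' : k + 2 * r - 1 ∉ S := fun hn => by simpa using hS.1.1 hn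
      have hT' : k + 2 * r - 1 ∉ T := fun hn => by simpa using hT.1.1 hn
      rw [← erase_insert hS', ← erase_insert hT']
      exact congrArg (fun U => U.erase (k + 2 * r - 1)) hST

end Family

end SquareGroebner
end

noncomputable section

namespace SquareGroebner

open MvPolynomial Finset

/-! ### Reduced Gröbner bases -/

section General

variable {σ : Type*} {K : Type*} [Field K] {m : MonomialOrder σ}

theorem monomial_mem_span_iff {E : Set (σ →₀ ℕ)} {s : σ →₀ ℕ} :
    (monomial s (1 : K)) ∈ Ideal.span ((fun e => monomial e (1 : K)) '' E) ↔ ∃ e ∈ E, e ≤ s := by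
  classical
  rw [mem_ideal_span_monomial_image, support_monomial, if_neg one_ne_zero]
  simp

theorem span_leadingTerm (G : Set (MvPolynomial σ K)) :
    Ideal.span (m.leadingTerm '' G) =
      Ideal.span ((fun e => monomial e (1 : K)) '' (m.degree '' (G \ {0}))) := by
  rw [MonomialOrder.span_leadingTerm_eq_span_monomial', Set.image_image]

theorem monomial_mem_initialIdeal_iff {I : Ideal (MvPolynomial σ K)} {s : σ →₀ ℕ} :
    (monomial s (1 : K)) ∈ initialIdeal m I ↔ ∃ f ∈ I, f ≠ 0 ∧ m.degree f ≤ s := by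
  rw [initialIdeal, span_leadingTerm, monomial_mem_span_iff]
  simp [and_assoc]

theorem degree_mem_initialIdeal {I : Ideal (MvPolynomial σ K)} {f : MvPolynomial σ K}
    (hf : f ∈ I) (h0 : f ≠ 0) : (monomial (m.degree f) (1 : K)) ∈ initialIdeal m I :=
  monomial_mem_initialIdeal_iff.2 ⟨f, hf, h0, le_rfl⟩

/-- If g and g' share their leading monomial, the leading terms cancel in g - g'. Were it nonzero,
its leading monomial would lie in in(I) and also in the tail of g or g'. -/
theorem IsReducedGroebnerBasis.le {I : Ideal (MvPolynomial σ K)} {G G' : Set (MvPolynomial σ K)}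
    (hG : IsReducedGroebnerBasis m I G) (hG' : IsReducedGroebnerBasis m I G') : G ⊆ G' := by
  intro g hg
  obtain ⟨g', hg', hdeg⟩ := hG'.bijOn.surjOn (hG.bijOn.mapsTo hg)
  have hdeg : m.degree g' = m.degree g := hdeg
  suffices h : g - g' = 0 by rw [sub_eq_zero.1 h]; exact hg'
  by_contra hne
  have hin := degree_mem_initialIdeal (m := m) (I.sub_mem (hG.subset hg) (hG'.subset hg')) hne
  have hs : m.degree (g - g') ≠ m.degree g := by
    intro h
    have h1 : coeff (m.degree g) g = 1 := hG.monic g hg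
    have h2 : coeff (m.degree g') g' = 1 := hG'.monic g' hg'
    rw [hdeg] at h2
    have h3 := m.coeff_degree_ne_zero_iff.2 hne
    rw [h, coeff_sub, h1, h2, sub_self] at h3
    exact h3 rfl
  have hsupp := m.coeff_degree_ne_zero_iff.2 hne
  by_cases hg0 : coeff (m.degree (g - g')) g = 0
  · rw [coeff_sub, hg0, zero_sub, neg_ne_zero] at hsupp
    exact hG'.tail g' hg' _ (mem_support_iff.2 hsupp) (hdeg ▸ hs) hin
  · exact hG.tail g hg _ (mem_support_iff.2 hg0) hs hin

theorem IsReducedGroebnerBasis.unique {I : Ideal (MvPolynomial σ K)}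
    {G G' : Set (MvPolynomial σ K)} (hG : IsReducedGroebnerBasis m I G)
    (hG' : IsReducedGroebnerBasis m I G') : G = G' :=
  (hG.le hG').antisymm (hG'.le hG)

/-- Reduces the definition to divisibility of exponents: under `hlead`, a monomial is in in(I)
exactly when some leading monomial from G divides it. -/
theorem isReducedGroebnerBasis_of_forall {I : Ideal (MvPolynomial σ K)}
    {G : Set (MvPolynomial σ K)} (hfin : G.Finite) (hsub : G ⊆ I)
    (hmonic : ∀ g ∈ G, m.leadingCoeff g = 1)
    (hlead : ∀ f ∈ I, f ≠ 0 → ∃ g ∈ G, m.degree g ≤ m.degree f)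
    (hanti : ∀ g ∈ G, ∀ g' ∈ G, m.degree g' ≤ m.degree g → g' = g)
    (htail : ∀ g ∈ G, ∀ s ∈ g.support, s ≠ m.degree g → ∀ g' ∈ G, ¬ m.degree g' ≤ s) :
    IsReducedGroebnerBasis m I G := by
  have hne : ∀ g ∈ G, g ≠ 0 := fun g hg h => by
    have := hmonic g hg
    rw [h] at this
    simp at this
  have hmem : ∀ s, (monomial s (1 : K)) ∈ initialIdeal m I ↔ ∃ g ∈ G, m.degree g ≤ s := by
    intro s
    rw [monomial_mem_initialIdeal_iff]
    constructor
    · rintro ⟨f, hf, h0, hle⟩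
      obtain ⟨g, hg, hgf⟩ := hlead f hf h0
      exact ⟨g, hg, hgf.trans hle⟩
    · rintro ⟨g, hg, hle⟩
      exact ⟨g, hsub hg, hne g hg, hle⟩
  refine ⟨⟨hfin, hsub, le_antisymm (Ideal.span_mono (Set.image_mono hsub)) ?_⟩, ⟨?_, ?_, ?_⟩,
    hmonic, ?_⟩
  · rw [initialIdeal, span_leadingTerm, span_leadingTerm, Ideal.span_le]
    rintro - ⟨-, ⟨f, ⟨hf, h0⟩, rfl⟩, rfl⟩
    obtain ⟨g, hg, hle⟩ := hlead f hf h0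
    exact monomial_mem_span_iff.2 ⟨_, ⟨g, ⟨hg, hne g hg⟩, rfl⟩, hle⟩
  · intro g hg
    refine ⟨(hmem _).2 ⟨g, hg, le_rfl⟩, fun t ht hle => ?_⟩
    obtain ⟨g', hg', h'⟩ := (hmem t).1 ht
    rwa [hanti g hg g' hg' (h'.trans hle)] at h'
  · intro g hg g' hg' h
    exact hanti g' hg' g hg (le_of_eq h)
  · intro s hs
    have hs : Minimal (fun t : σ →₀ ℕ => (monomial t (1 : K)) ∈ initialIdeal m I) s := hs
    obtain ⟨g, hg, hle⟩ := (hmem s).1 hs.prop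
    exact ⟨g, hg, hle.antisymm (hs.le_of_le ((hmem _).2 ⟨g, hg, le_rfl⟩) hle)⟩
  · intro g hg s hs hsne hin
    obtain ⟨g', hg', hle⟩ := (hmem s).1 hin
    exact htail g hg s hs hsne g' hg' hle

end General

/-! ### Square-free monomials and elementary symmetric polynomials -/

section SquareFree

variable {σ : Type*} {K : Type*}

/-- The exponent of the square-free monomial `∏ i ∈ S, x_i`. -/
def sqfreeExp (S : Finset σ) : σ →₀ ℕ := ∑ i ∈ S, Finsupp.single i 1

open Classical in
theorem sqfreeExp_apply (S : Finset σ) (i : σ) : sqfreeExp S i = if i ∈ S then 1 else 0 := by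
  simp [sqfreeExp, Finsupp.finsetSum_apply, Finsupp.single_apply]

theorem sqfreeExp_injective : Function.Injective (sqfreeExp : Finset σ → σ →₀ ℕ) := by
  classical
  intro S T h
  ext i
  have := DFunLike.congr_fun h i
  rw [sqfreeExp_apply, sqfreeExp_apply] at this
  split_ifs at this <;> simp_all

theorem support_sqfreeExp (S : Finset σ) : (sqfreeExp S).support = S := by
  classical
  ext i
  simp [sqfreeExp_apply]

theorem sqfreeExp_support {s : σ →₀ ℕ} (h : ∀ i, s i < 2) : sqfreeExp s.support = s := by
  classical
  ext i
  have := h i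
  rw [sqfreeExp_apply]
  split_ifs with hi
  · rw [Finsupp.mem_support_iff] at hi
    omega
  · rw [Finsupp.notMem_support_iff] at hi
    omega

theorem sqfreeExp_le_iff {S : Finset σ} {s : σ →₀ ℕ} : sqfreeExp S ≤ s ↔ S ⊆ s.support := by
  classical
  constructor
  · intro h i hi
    have := h i
    rw [sqfreeExp_apply, if_pos hi] at this
    rw [Finsupp.mem_support_iff]
    omega
  · intro h i
    rw [sqfreeExp_apply]
    split_ifs with hi
    · have := Finsupp.mem_support_iff.1 (h hi)
      omega
    · exact zero_le

theorem degree_sqfreeExp (S : Finset σ) : (sqfreeExp S).degree = S.card := by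
  simp [sqfreeExp]

variable [CommSemiring K]

theorem prod_X_eq_monomial_sqfreeExp (S : Finset σ) :
    ∏ i ∈ S, (X i : MvPolynomial σ K) = monomial (sqfreeExp S) 1 := by
  rw [sqfreeExp, monomial_sum_one]; rfl

/-! ### Powers of sums of square-zero elements -/

theorem add_pow_succ_of_sq_eq_zero {R : Type*} [CommSemiring R] {x : R} (hx : x ^ 2 = 0) (y : R)
    (d : ℕ) : (x + y) ^ (d + 1) = y ^ (d + 1) + (d + 1) * (x * y ^ d) := by
  induction d with
  | zero => simp [add_comm]
  | succ d ih =>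
    have : (x + y) ^ (d + 1 + 1) = y ^ (d + 1 + 1) + (d + 1 + 1) * (x * y ^ (d + 1)) +
        x ^ 2 * ((d + 1) * y ^ d) := by rw [pow_succ, ih]; ring
    rw [this, hx]
    push_cast
    ring

/-- The power of a sum of elements of square zero. -/
theorem sum_pow_of_sq_eq_zero {R ι : Type*} [CommSemiring R] {f : ι → R} (T : Finset ι)
    (hf : ∀ i ∈ T, f i ^ 2 = 0) (d : ℕ) :
    (∑ i ∈ T, f i) ^ d = d.factorial * ∑ t ∈ T.powersetCard d, ∏ i ∈ t, f i := by
  classical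
  induction T using Finset.induction_on generalizing d with
  | empty =>
    cases d with
    | zero => simp
    | succ d =>
      rw [powersetCard_eq_empty.2 (by simp)]
      simp
  | insert a T ha ih =>
    cases d with
    | zero => simp
    | succ d =>
      have ih' := ih fun i hi => hf i (mem_insert_of_mem hi)
      rw [sum_insert ha, add_pow_succ_of_sq_eq_zero (hf a (mem_insert_self _ _)), ih', ih',
        powersetCard_succ_insert ha, sum_union, sum_image]
      · have : ∑ t ∈ T.powersetCard d, ∏ i ∈ insert a t, f i =
            f a * ∑ t ∈ T.powersetCard d, ∏ i ∈ t, f i := by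
          rw [mul_sum]
          refine sum_congr rfl fun t ht => ?_
          rw [prod_insert fun h => ha ((mem_powersetCard.1 ht).1 h)]
        rw [this, Nat.factorial_succ]
        push_cast
        ring
      · intro S hS U hU h
        have hS' : a ∉ S := fun h => ha ((mem_powersetCard.1 hS).1 h)
        have hU' : a ∉ U := fun h => ha ((mem_powersetCard.1 hU).1 h)
        rw [← erase_insert hS', ← erase_insert hU']
        exact congrArg (fun V => V.erase a) h
      · rw [disjoint_left]
        intro S hS hS'
        obtain ⟨U, -, rfl⟩ := mem_image.1 hS'
        exact ha ((mem_powersetCard.1 hS).1 (mem_insert_self _ _))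

/-- The sum over T is the full sum, whose k-th power is 0, minus the sum over the complement, whose
power |Tᶜ| + 1 is 0 because no subset is that large. -/
theorem sum_pow_eq_zero_of_compl {R ι : Type*} [CommRing R] [Fintype ι] [DecidableEq ι]
    {f : ι → R} (hf : ∀ i, f i ^ 2 = 0) {k : ℕ} (hk : (∑ i, f i) ^ k = 0) (T : Finset ι) {d : ℕ}
    (h : Tᶜ.card + k ≤ d) : (∑ i ∈ T, f i) ^ d = 0 := by
  have hz : (-∑ i ∈ Tᶜ, f i) ^ (Tᶜ.card + 1) = 0 := by
    rw [neg_pow, sum_pow_of_sq_eq_zero _ (fun i _ => hf i),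
      powersetCard_eq_empty.2 (Nat.lt_succ_self _)]
    simp
  have hsum : ∑ i ∈ T, f i = ∑ i, f i + -∑ i ∈ Tᶜ, f i := by
    rw [← sum_add_sum_compl T]; ring
  rw [hsum]
  exact (Commute.all _ _).add_pow_eq_zero_of_add_le_succ_of_pow_eq_zero hk hz (by omega)

end SquareFree

section Ideal

variable {K : Type*} [Field K] {n k : ℕ}

theorem X_sq_mem_squareIdeal (i : Fin n) :
    (X i : MvPolynomial (Fin n) K) ^ 2 ∈ squareIdeal K n k :=
  Ideal.subset_span (Or.inl ⟨i, rfl⟩)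

/-- An elementary symmetric polynomial of degree `d` in all but at most `d - k` variables lies in
the ideal. -/
theorem sum_prod_X_mem_squareIdeal [CharZero K] (T : Finset (Fin n)) {d : ℕ}
    (h : Tᶜ.card + k ≤ d) :
    ∑ t ∈ T.powersetCard d, ∏ i ∈ t, (X i : MvPolynomial (Fin n) K) ∈ squareIdeal K n k := by
  set I := squareIdeal K n k
  set x : Fin n → MvPolynomial (Fin n) K ⧸ I := fun i => Ideal.Quotient.mk I (X i)
  have hx : ∀ i, x i ^ 2 = 0 := fun i => by
    rw [← map_pow]
    exact Ideal.Quotient.eq_zero_iff_mem.2 (X_sq_mem_squareIdeal i)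
  have hl : (∑ i, x i) ^ k = 0 := by
    rw [← map_sum, ← map_pow]
    exact Ideal.Quotient.eq_zero_iff_mem.2 (Ideal.subset_span (Or.inr rfl))
  have hy := sum_pow_eq_zero_of_compl hx hl T h
  rw [sum_pow_of_sq_eq_zero _ (fun i _ => hx i)] at hy
  have hmem : (d.factorial : MvPolynomial (Fin n) K) *
      ∑ t ∈ T.powersetCard d, ∏ i ∈ t, (X i : MvPolynomial (Fin n) K) ∈ I := by
    rw [← Ideal.Quotient.eq_zero_iff_mem, ← hy]
    simp [x]
  have hd : (d.factorial : K) ≠ 0 := by exact_mod_cast d.factorial_ne_zero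
  have := I.mul_mem_left (C (d.factorial : K)⁻¹) hmem
  rwa [← mul_assoc, ← map_natCast (C : K →+* MvPolynomial (Fin n) K), ← C_mul,
    inv_mul_cancel₀ hd, C_1, one_mul] at this

/-! ### The polynomials `g_A` -/

variable {A : Finset (Fin n)}

theorem mem_indexSet {i : Fin n} : i ∈ indexSet k A ↔ i ∈ A ∨ 2 * A.card ≤ i + k := by
  simp only [indexSet, mem_union, mem_filter, mem_univ, true_and]
  refine or_congr_right ?_
  rw [varIndex]
  push_cast
  omega

theorem gPoly_eq_sum : gPoly K k A =
    ∑ t ∈ (indexSet k A).powersetCard A.card, ∏ i ∈ t, (X i : MvPolynomial (Fin n) K) := by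
  rw [gPoly, esymm_map_val]

theorem gPoly_eq_sum_monomial : gPoly K k A =
    ∑ t ∈ (indexSet k A).powersetCard A.card, monomial (sqfreeExp t) (1 : K) := by
  rw [gPoly_eq_sum]
  exact sum_congr rfl fun t _ => prod_X_eq_monomial_sqfreeExp t

theorem support_gPoly : (gPoly K k A).support =
    ((indexSet k A).powersetCard A.card).map ⟨sqfreeExp, sqfreeExp_injective⟩ := by
  classical
  ext s
  rw [mem_support_iff, gPoly_eq_sum_monomial, coeff_sum]
  simp only [coeff_monomial, mem_map, Function.Embedding.coeFn_mk]
  constructor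
  · intro h
    obtain ⟨t, ht, hne⟩ := exists_ne_zero_of_sum_ne_zero h
    exact ⟨t, ht, by simpa using hne⟩
  · rintro ⟨t, ht, rfl⟩
    rw [sum_eq_single_of_mem t ht fun u _ hu => if_neg (sqfreeExp_injective.ne hu), if_pos rfl]
    exact one_ne_zero

theorem self_mem_powersetCard_indexSet : A ∈ (indexSet k A).powersetCard A.card :=
  mem_powersetCard.2 ⟨fun _ hi => mem_indexSet.2 (Or.inl hi), rfl⟩

theorem coeff_gPoly_self : coeff (sqfreeExp A) (gPoly K k A) = 1 := by
  classical
  rw [gPoly_eq_sum_monomial, coeff_sum]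
  simp only [coeff_monomial]
  rw [sum_eq_single_of_mem A self_mem_powersetCard_indexSet
    fun u _ hu => if_neg (sqfreeExp_injective.ne hu), if_pos rfl]

/-- The missing variables are the positions up to max(A) = 2|A| - k outside A. Thus |A| is exactly
the least degree that `sum_prod_X_mem_squareIdeal` admits. -/
theorem MaxCondition.card_indexSet_compl (hA : MaxCondition k A) :
    (indexSet k A)ᶜ.card + k = A.card := by
  obtain ⟨i, hi, hmax, hc⟩ := maxCondition_iff.1 hA
  have hI : ((indexSet k A)ᶜ ∪ A).card = (i : ℕ) + 1 := by
    have : (indexSet k A)ᶜ ∪ A = Finset.Iic i := by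
      ext x
      simp only [mem_union, mem_compl, mem_indexSet, mem_Iic, Fin.le_def]
      by_cases hx : x ∈ A
      · simpa [hx] using hmax x hx
      · simp only [hx, false_or, or_false]; omega
    rw [this, Fin.card_Iic]
  rw [card_union_of_disjoint] at hI
  · omega
  · rw [disjoint_left]
    intro x hx hxA
    exact mem_compl.1 hx (mem_indexSet.2 (Or.inl hxA))

theorem MaxCondition.card_indexSet (hA : MaxCondition k A) :
    (indexSet k A).card = n - A.card + k := by
  have h1 := hA.card_indexSet_compl
  have h2 := card_add_card_compl (indexSet k A)
  rw [Fintype.card_fin] at h2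
  have h3 : A.card ≤ n := by simpa using card_le_univ A
  omega

theorem MaxCondition.card_support_gPoly (hA : MaxCondition k A) :
    (gPoly K k A).support.card = (n - A.card + k).choose A.card := by
  rw [support_gPoly, card_map, card_powersetCard, hA.card_indexSet]

theorem MaxCondition.gPoly_mem [CharZero K] (hA : MaxCondition k A) :
    gPoly K k A ∈ squareIdeal K n k := by
  rw [gPoly_eq_sum]
  exact sum_prod_X_mem_squareIdeal _ hA.card_indexSet_compl.le

/-! ### Leading terms -/

variable {m : MonomialOrder (Fin n)}

theorem toSyn_sqfreeExp (S : Finset (Fin n)) :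
    m.toSyn (sqfreeExp S) = ∑ i ∈ S, m.toSyn (Finsupp.single i 1) := by
  rw [sqfreeExp, map_sum]

theorem sum_le_sum_of_card_eq {ι M : Type*} [AddCommMonoid M] [LinearOrder M]
    [IsOrderedAddMonoid M] {S T : Finset ι} (w : ι → M) (hcard : S.card = T.card)
    (h : ∀ i ∈ S, ∀ j ∈ T, w i ≤ w j) : ∑ i ∈ S, w i ≤ ∑ j ∈ T, w j := by
  rcases S.eq_empty_or_nonempty with rfl | hS
  · rw [card_empty, eq_comm, card_eq_zero] at hcard
    rw [hcard]
  · obtain ⟨c, hc, hmax⟩ := exists_max_image S w hS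
    calc ∑ i ∈ S, w i ≤ S.card • w c := sum_le_card_nsmul _ _ _ hmax
      _ = T.card • w c := by rw [hcard]
      _ ≤ ∑ j ∈ T, w j := card_nsmul_le_sum _ _ _ fun j hj => h c hc j hj

/-- After cancelling t ∩ A, the rest of t lies beyond max(A). Since max(A) = k + 2(|A| - k) closes a
block, every variable there is smaller than every variable of A. -/
theorem MaxCondition.toSyn_le (hm : InducesBlockRanking k m) (hA : MaxCondition k A)
    {t : Finset (Fin n)} (ht : t ∈ (indexSet k A).powersetCard A.card) :
    m.toSyn (sqfreeExp t) ≤ m.toSyn (sqfreeExp A) := by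
  rw [mem_powersetCard] at ht
  rw [toSyn_sqfreeExp, toSyn_sqfreeExp, ← sum_inter_add_sum_sdiff t A,
    ← sum_inter_add_sum_sdiff A t, inter_comm A t]
  refine add_le_add_right (sum_le_sum_of_card_eq _ ?_ fun i hi j hj => (hm j i ?_).le) _
  · have h1 := card_inter_add_card_sdiff t A
    have h2 := card_inter_add_card_sdiff A t
    rw [inter_comm] at h2
    omega
  · rw [mem_sdiff] at hi hj
    have hi' := (mem_indexSet.1 (ht.1 hi.1)).resolve_left hi.2
    obtain ⟨l, hl, hmax, hc⟩ := maxCondition_iff.1 hA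
    have hk := hA.le_card
    have hj' := Fin.le_def.1 (hmax j hj.1)
    simp only [blockIndex]
    split_ifs <;> simp only [varIndex] at * <;> omega

theorem MaxCondition.degree_gPoly (hm : InducesBlockRanking k m) (hA : MaxCondition k A) :
    m.degree (gPoly K k A) = sqfreeExp A := by
  apply m.toSyn.injective
  apply le_antisymm
  · rw [MonomialOrder.degree_le_iff]
    intro s hs
    rw [support_gPoly, mem_map] at hs
    obtain ⟨t, ht, rfl⟩ := hs
    exact hA.toSyn_le hm ht
  · apply m.le_degree
    rw [mem_support_iff, coeff_gPoly_self]
    exact one_ne_zero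

theorem MaxCondition.leadingCoeff_gPoly (hm : InducesBlockRanking k m) (hA : MaxCondition k A) :
    m.leadingCoeff (gPoly K k A) = 1 := by
  rw [MonomialOrder.leadingCoeff, hA.degree_gPoly hm, coeff_gPoly_self]

theorem MaxCondition.leadingTerm_gPoly (hm : InducesBlockRanking k m) (hA : MaxCondition k A) :
    m.leadingTerm (gPoly K k A) = ∏ a ∈ A, (X a : MvPolynomial (Fin n) K) := by
  rw [MonomialOrder.leadingTerm, hA.degree_gPoly hm, hA.leadingCoeff_gPoly hm,
    prod_X_eq_monomial_sqfreeExp]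

/-- A minimal B inside t has max(B) ≤ max(A), where t only contains elements of A; so B = A, and
equal sizes give t = A. Tails are therefore reduced. -/
theorem not_finReaches_of_mem_powersetCard (hk : 1 ≤ k) (hA : A ∈ minimalFamily n k)
    {t : Finset (Fin n)} (ht : t ∈ (indexSet k A).powersetCard A.card) (hne : t ≠ A) :
    ¬ FinReaches k t := by
  intro hr
  obtain ⟨B, hB, hBt⟩ := (finReaches_iff hk).1 hr
  rw [mem_powersetCard] at ht
  have hBA : B = A := eq_of_maxCondition_of_subset hA hB.prop
    ((card_le_card hBt).trans ht.2.le) fun i hi hlt =>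
      (mem_indexSet.1 (ht.1 (hBt hi))).resolve_right (by omega)
  subst hBA
  exact hne (eq_of_subset_of_card_le hBt ht.2.le).symm

/-! ### The initial ideal -/

/-- Vectors with distinct leading coordinates are independent: in a relation, look at the largest
leading coordinate with nonzero coefficient. -/
theorem card_le_finrank_of_triangular {ι Γ : Type*} [Fintype ι] [LinearOrder Γ] {w : ι → Γ}
    (hw : Function.Injective w) (W : Submodule K (ι → K)) (B : Finset ι)
    (h : ∀ i ∈ B, ∃ v ∈ W, v i ≠ 0 ∧ ∀ j, w i < w j → v j = 0) :
    B.card ≤ Module.finrank K W := by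
  classical
  choose! v hvW hv hv0 using h
  have hli : LinearIndependent K (fun i : B => (⟨v i, hvW i i.2⟩ : W)) := by
    rw [Fintype.linearIndependent_iff]
    intro c hc
    by_contra! hne
    obtain ⟨i₀, hi₀⟩ := hne
    obtain ⟨i, hi, hmax⟩ := exists_max_image (univ.filter fun i : B => c i ≠ 0) (fun i => w i)
      ⟨i₀, by simpa using hi₀⟩
    have h1 : ∑ j : B, c j * v j i = 0 := by
      have := congrFun (congrArg Subtype.val hc) i
      simpa using this
    rw [sum_eq_single_of_mem i (mem_univ _)] at h1
    · exact mul_ne_zero (by simpa using hi) (hv i i.2) h1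
    · intro j _ hji
      by_cases hcj : c j = 0
      · rw [hcj, zero_mul]
      · have hlt : w j < w i := lt_of_le_of_ne (hmax j (by simpa using hcj))
          (fun h => hji (Subtype.ext (hw h)))
        rw [hv0 j j.2 i hlt, mul_zero]
  simpa using hli.fintype_card_le_finrank

variable (K n) in
/-- The coefficients at the square-free monomials. -/
def sqfreeCoeffs : MvPolynomial (Fin n) K →ₗ[K] (Finset (Fin n) → K) :=
  LinearMap.pi fun S => lcoeff K (sqfreeExp S)

theorem sqfreeCoeffs_apply (f : MvPolynomial (Fin n) K) (S : Finset (Fin n)) :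
    sqfreeCoeffs K n f S = coeff (sqfreeExp S) f := rfl

variable (K n k) in
/-- Vectors that span a space containing the coefficient vectors of the elements of the ideal. -/
def spanningVectors :
    {S : Finset (Fin n) // 2 * S.card + k ≤ n} ⊕ {S : Finset (Fin n) // n + k < 2 * S.card} →
      (Finset (Fin n) → K) :=
  Sum.elim
    (fun S => sqfreeCoeffs K n (monomial (sqfreeExp (S : Finset (Fin n))) 1 * (∑ i, X i) ^ k))
    (fun S => Pi.single (S : Finset (Fin n)) 1)

theorem finrank_spanningVectors_le (hk : 1 ≤ k) [DecidablePred (FinReaches (n := n) k)] :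
    Module.finrank K (Submodule.span K (Set.range (spanningVectors K n k))) ≤
      (univ.filter (fun S : Finset (Fin n) => FinReaches k S)).card := by
  classical
  refine (finrank_range_le_card _).trans ?_
  rw [Fintype.card_sum, Fintype.card_subtype, Fintype.card_subtype]
  convert (card_small_add_card_large (n := n) hk).le

theorem sqfreeCoeffs_monomial_mul_mem (s : Fin n →₀ ℕ) (c : K) :
    sqfreeCoeffs K n (monomial s c * (∑ i, X i) ^ k) ∈
      Submodule.span K (Set.range (spanningVectors K n k)) := by
  classical
  by_cases hs : ∀ i, s i < 2
  · obtain ⟨S, rfl⟩ : ∃ S, s = sqfreeExp S := ⟨_, (sqfreeExp_support hs).symm⟩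
    have hc : monomial (sqfreeExp S) c * (∑ i, X i) ^ k =
        c • (monomial (sqfreeExp S) 1 * (∑ i, X i : MvPolynomial (Fin n) K) ^ k) := by
      rw [← smul_mul_assoc, smul_monomial, smul_eq_mul, mul_one]
    rw [hc, map_smul]
    refine Submodule.smul_mem _ _ ?_
    by_cases hS : 2 * S.card + k ≤ n
    · exact Submodule.subset_span ⟨Sum.inl ⟨S, hS⟩, rfl⟩
    -- Here 2|S| + k > n, so the product is homogeneous of degree |S| + k > (n + k)/2 and only unit
    -- vectors of large sets occur.
    · set v := sqfreeCoeffs K n (monomial (sqfreeExp S) 1 * (∑ i, X i) ^ k)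
      have hhom : (monomial (sqfreeExp S) 1 *
          (∑ i, X i : MvPolynomial (Fin n) K) ^ k).IsHomogeneous (S.card + 1 * k) :=
        (isHomogeneous_monomial _ (degree_sqfreeExp S)).mul
          ((IsHomogeneous.sum _ _ _ fun i _ => isHomogeneous_X _ _).pow k)
      have hv : v = ∑ T, v T • (Pi.single T (1 : K) : Finset (Fin n) → K) := by
        ext U
        simp [Finset.sum_apply, Pi.single_apply]
      rw [hv]
      refine Submodule.sum_mem _ fun T _ => ?_
      by_cases hT : T.card = S.card + 1 * k
      · exact Submodule.smul_mem _ _ (Submodule.subset_span ⟨Sum.inr ⟨T, by omega⟩, rfl⟩)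
      · have : v T = 0 := hhom.coeff_eq_zero (by rwa [degree_sqfreeExp])
        rw [this, zero_smul]
        exact zero_mem _
  · push Not at hs
    obtain ⟨i, hi⟩ := hs
    have : sqfreeCoeffs K n (monomial s c * (∑ i, X i) ^ k) = 0 := by
      ext S
      rw [sqfreeCoeffs_apply, coeff_monomial_mul', if_neg]
      · rfl
      · intro hle
        have := hle i
        rw [sqfreeExp_apply] at this
        split_ifs at this <;> omega
    rw [this]
    exact zero_mem _

theorem sqfreeCoeffs_mul_X_sq (p : MvPolynomial (Fin n) K) (i : Fin n) :
    sqfreeCoeffs K n (p * X i ^ 2) = 0 := by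
  classical
  ext S
  rw [sqfreeCoeffs_apply, X_pow_eq_monomial, coeff_mul_monomial', if_neg]
  · rfl
  · intro hle
    have := hle i
    rw [sqfreeExp_apply, Finsupp.single_eq_same] at this
    split_ifs at this <;> omega

theorem sqfreeCoeffs_mem_span {f : MvPolynomial (Fin n) K} (hf : f ∈ squareIdeal K n k) :
    sqfreeCoeffs K n f ∈ Submodule.span K (Set.range (spanningVectors K n k)) := by
  -- Quantifying over all multiples makes the claim stable under multiplication in the span
  -- induction.
  suffices h : ∀ p, sqfreeCoeffs K n (p * f) ∈
      Submodule.span K (Set.range (spanningVectors K n k)) by simpa using h 1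
  rw [squareIdeal] at hf
  induction hf using Submodule.span_induction with
  | mem g hg =>
    intro p
    rcases hg with ⟨i, rfl⟩ | rfl
    · rw [sqfreeCoeffs_mul_X_sq]
      exact zero_mem _
    · induction p using MvPolynomial.induction_on' with
      | monomial s c => exact sqfreeCoeffs_monomial_mul_mem s c
      | add p q hp hq =>
        rw [add_mul, map_add]
        exact add_mem hp hq
  | zero => intro p; simp
  | add g g' _ _ hg hg' =>
    intro p
    rw [mul_add, map_add]
    exact add_mem (hg p) (hg' p)
  | smul q g _ hg =>
    intro p
    rw [smul_eq_mul, ← mul_assoc]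
    exact hg _

/-- Otherwise the leading monomial of f is square-free with a non-reaching walk. Together with the
reaching sets it gives one more independent coefficient vector than the spanning family allows. -/
theorem exists_two_le_or_finReaches_degree [CharZero K] (hk : 1 ≤ k)
    (hm : InducesBlockRanking k m) {f : MvPolynomial (Fin n) K} (hf : f ∈ squareIdeal K n k)
    (h0 : f ≠ 0) : (∃ i, 2 ≤ m.degree f i) ∨ FinReaches k (m.degree f).support := by
  classical
  by_contra! hcon
  obtain ⟨hsq, hr⟩ := hcon
  obtain ⟨T, hT⟩ : ∃ T, m.degree f = sqfreeExp T := ⟨_, (sqfreeExp_support hsq).symm⟩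
  rw [hT, support_sqfreeExp] at hr
  have h := card_le_finrank_of_triangular (w := fun S => m.toSyn (sqfreeExp S))
    (m.toSyn.injective.comp sqfreeExp_injective)
    (Submodule.span K (Set.range (spanningVectors K n k)))
    (insert T (univ.filter fun S => FinReaches k S)) (by
      intro S hS
      suffices hg : ∃ g ∈ squareIdeal K n k, g ≠ 0 ∧ m.degree g = sqfreeExp S by
        obtain ⟨g, hg, hg0, hdeg⟩ := hg
        refine ⟨_, sqfreeCoeffs_mem_span hg, ?_, fun U hU => ?_⟩
        · rw [sqfreeCoeffs_apply, ← hdeg]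
          exact m.coeff_degree_ne_zero_iff.2 hg0
        · rw [sqfreeCoeffs_apply]
          exact m.coeff_eq_zero_of_lt (by rwa [hdeg])
      rw [mem_insert, mem_filter] at hS
      rcases hS with rfl | ⟨-, hS⟩
      · exact ⟨f, hf, h0, hT⟩
      · obtain ⟨A, hA, hAS⟩ := (finReaches_iff hk).1 hS
        have hg0 : gPoly K k A ≠ 0 := by
          intro h
          have := coeff_gPoly_self (K := K) (k := k) (A := A)
          rw [h, coeff_zero] at this
          exact zero_ne_one this
        have hm0 : monomial (sqfreeExp (S \ A)) (1 : K) ≠ 0 := by simp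
        -- Each reaching S is realised as a leading monomial by completing x_A to x_S.
        refine ⟨monomial (sqfreeExp (S \ A)) 1 * gPoly K k A,
          Ideal.mul_mem_left _ _ hA.prop.gPoly_mem, mul_ne_zero hm0 hg0, ?_⟩
        rw [m.degree_mul hm0 hg0, m.degree_monomial, if_neg one_ne_zero, hA.prop.degree_gPoly hm]
        exact sum_sdiff hAS)
  rw [card_insert_of_notMem (by simpa using hr)] at h
  have := h.trans (finrank_spanningVectors_le hk)
  omega

/-! ### The reduced Gröbner basis -/

theorem mem_basisSet {g : MvPolynomial (Fin n) K} :
    g ∈ basisSet K n k ↔ (∃ i, g = X i ^ 2) ∨ ∃ A ∈ minimalFamily n k, g = gPoly K k A := by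
  simp only [basisSet, Set.mem_union, Set.mem_range, Set.mem_iUnion, Set.mem_ofPred_eq,
    exists_prop, mem_Icc]
  refine or_congr ⟨?_, ?_⟩ ⟨?_, ?_⟩
  · rintro ⟨i, rfl⟩; exact ⟨i, rfl⟩
  · rintro ⟨i, rfl⟩; exact ⟨i, rfl⟩
  · rintro ⟨d, -, A, hA, -, rfl⟩; exact ⟨A, hA, rfl⟩
  · rintro ⟨A, hA, rfl⟩
    have h1 := hA.prop.le_card
    have h2 := hA.prop.two_mul_card_le
    exact ⟨A.card, ⟨h1, by omega⟩, A, hA, rfl, rfl⟩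

theorem degree_X_sq (i : Fin n) :
    m.degree (X i ^ 2 : MvPolynomial (Fin n) K) = Finsupp.single i 2 := by
  classical
  rw [X_pow_eq_monomial, m.degree_monomial, if_neg one_ne_zero]

theorem single_two_not_le_sqfreeExp (i : Fin n) (S : Finset (Fin n)) :
    ¬ Finsupp.single i 2 ≤ sqfreeExp S := by
  classical
  intro h
  have := h i
  rw [sqfreeExp_apply, Finsupp.single_eq_same] at this
  split_ifs at this <;> omega

theorem isReducedGroebnerBasis_basisSet [CharZero K] (hk : 2 ≤ k)
    (hm : InducesBlockRanking k m) :
    IsReducedGroebnerBasis m (squareIdeal K n k) (basisSet K n k) := by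
  classical
  have hk1 : 1 ≤ k := by omega
  apply isReducedGroebnerBasis_of_forall
  · have : basisSet K n k ⊆ Set.range (fun i => (X i ^ 2 : MvPolynomial (Fin n) K)) ∪
        Set.range (gPoly K k) := by
      intro g hg
      rcases mem_basisSet.1 hg with ⟨i, rfl⟩ | ⟨A, -, rfl⟩
      · exact Or.inl ⟨i, rfl⟩
      · exact Or.inr ⟨A, rfl⟩
    exact ((Set.finite_range _).union (Set.finite_range _)).subset this
  · intro g hg
    rcases mem_basisSet.1 hg with ⟨i, rfl⟩ | ⟨A, hA, rfl⟩
    · exact X_sq_mem_squareIdeal i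
    · exact hA.prop.gPoly_mem
  · intro g hg
    rcases mem_basisSet.1 hg with ⟨i, rfl⟩ | ⟨A, hA, rfl⟩
    · rw [X_pow_eq_monomial, m.leadingCoeff_monomial]
    · exact hA.prop.leadingCoeff_gPoly hm
  · intro f hf h0
    rcases exists_two_le_or_finReaches_degree hk1 hm hf h0 with ⟨i, hi⟩ | hr
    · refine ⟨X i ^ 2, mem_basisSet.2 (Or.inl ⟨i, rfl⟩), ?_⟩
      rwa [degree_X_sq, Finsupp.single_le_iff]
    · obtain ⟨A, hA, hle⟩ := (finReaches_iff hk1).1 hr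
      refine ⟨gPoly K k A, mem_basisSet.2 (Or.inr ⟨A, hA, rfl⟩), ?_⟩
      rwa [hA.prop.degree_gPoly hm, sqfreeExp_le_iff]
  · intro g hg g' hg' hle
    rcases mem_basisSet.1 hg with ⟨i, rfl⟩ | ⟨A, hA, rfl⟩ <;>
      rcases mem_basisSet.1 hg' with ⟨i', rfl⟩ | ⟨A', hA', rfl⟩
    · rw [degree_X_sq, degree_X_sq, Finsupp.single_le_iff] at hle
      by_cases hi : i = i'
      · rw [hi]
      · rw [Finsupp.single_eq_of_ne (Ne.symm hi)] at hle
        omega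
    · rw [degree_X_sq, hA'.prop.degree_gPoly hm, sqfreeExp_le_iff] at hle
      -- Here k ≥ 2 is essential: x_A involves at least k variables, so it cannot divide a square.
      have h1 := (card_le_card hle).trans (card_le_card Finsupp.support_single_subset)
      have h2 := hA'.prop.le_card
      rw [card_singleton] at h1
      omega
    · rw [degree_X_sq, hA.prop.degree_gPoly hm] at hle
      exact absurd hle (single_two_not_le_sqfreeExp _ _)
    · rw [hA.prop.degree_gPoly hm, hA'.prop.degree_gPoly hm, sqfreeExp_le_iff,
        support_sqfreeExp] at hle
      rw [hle.antisymm (hA.le_of_le hA'.prop hle)]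
  · intro g hg s hs hsne g' hg' hle
    rcases mem_basisSet.1 hg with ⟨i, rfl⟩ | ⟨A, hA, rfl⟩
    · rw [degree_X_sq] at hsne
      rw [X_pow_eq_monomial, support_monomial, if_neg one_ne_zero, mem_singleton] at hs
      exact hsne hs
    · rw [hA.prop.degree_gPoly hm] at hsne
      rw [support_gPoly, mem_map] at hs
      obtain ⟨t, ht, rfl⟩ := hs
      rw [Function.Embedding.coeFn_mk] at hsne hle
      rcases mem_basisSet.1 hg' with ⟨i, rfl⟩ | ⟨B, hB, rfl⟩
      · rw [degree_X_sq] at hle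
        exact single_two_not_le_sqfreeExp _ _ hle
      · rw [hB.prop.degree_gPoly hm, sqfreeExp_le_iff, support_sqfreeExp] at hle
        exact not_finReaches_of_mem_powersetCard hk1 hA ht (fun h => hsne (by rw [h]))
          (hB.prop.finReaches hle)

end Ideal

end SquareGroebner

end

theorem theorem2 (K : Type*) [Field K] [CharZero K] (n k : ℕ) (hk : 2 ≤ k) :
    -- Groebner basis, for every term order inducing the block ranking
    (∀ m : MonomialOrder (Fin n), InducesBlockRanking k m →
      (∀ G : Set (MvPolynomial (Fin n) K),
        IsReducedGroebnerBasis m (squareIdeal K n k) G ↔ G = basisSet K n k) ∧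
      (∀ A ∈ minimalFamily n k,
        m.leadingTerm (gPoly K k A) = ∏ a ∈ A, (MvPolynomial.X a : MvPolynomial (Fin n) K))) ∧
    -- the degrees that occur, the number of variables and the number of terms
    (∀ A ∈ minimalFamily n k,
      k ≤ A.card ∧ A.card ≤ (n + k) / 2 ∧
      (indexSet k A).card = n - A.card + k ∧
      (gPoly K k A).support.card = (n - A.card + k).choose A.card) ∧
    -- the number of sets of each size
    (∀ r : ℕ,
      {A : Finset (Fin n) | A ∈ minimalFamily n k ∧ A.card = k + r}.ncard =
        if n < 2 * r + k then 0 else selfConvolution catalan (k - 1) r) := by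
  refine ⟨fun m hm => ⟨fun G => ?_, fun A hA => hA.prop.leadingTerm_gPoly hm⟩, fun A hA => ?_,
    ncard_minimalFamily (by omega)⟩
  · have h := isReducedGroebnerBasis_basisSet (K := K) hk hm
    exact ⟨fun hG => hG.unique h, fun hG => hG ▸ h⟩
  · have h := hA.prop.two_mul_card_le
    exact ⟨hA.prop.le_card, by omega, hA.prop.card_indexSet, hA.prop.card_support_gPoly⟩
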